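/- Let $d\ge 0$. For a domain (nonempty connected open set) $D\subset\mathbb C^d$ let $K_D$ be its Kobayashi pseudodistance: $K_D(x,y)$ is the infimum of $\sum_{i=1}^n\rho(a_i,b_i)$ over all finite chains of holomorphic maps $f_1,\dots,f_n:\mathbb D\to D$ and points $a_i,b_i$ of the unit disc $\mathbb D$ with $f_1(a_1)=x$, $f_i(b_i)=f_{i+1}(a_{i+1})$ for $1\le i<n$, and $f_n(b_n)=y$, where $\rho(a,b)=\operatorname{artanh}\left|\frac{a-b}{1-\bar a b}\right|$ is the Poincaré distance. The domain $D$ is called complete hyperbolic if $(D,K_D)$ is a complete metric space. A geodesic segment of $(D,K_D)$ from $x$ to $y$ is the image of a map $\gamma:[0,L]\to D$, $L\ge 0$, with $\gamma(0)=x$, $\gamma(L)=y$ and $K_D(\gamma(s),\gamma(t))=|s-t|$ for all $s,t\in[0,L]$. A couple of points $p\neq q$ of the Euclidean boundary $\partial D$ has the visibility condition with respect to $K_D$ if there are disjoint neighborhoods $V_p$ of $p$ and $V_q$ of $q$ in $\mathbb C^d$ and a compact set $K\subset D$ such that every geodesic segment of $(D,K_D)$ from a point of $V_p\cap D$ to a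 point of $V_q\cap D$ meets $K$. A bounded domain $\Omega\subset\mathbb C^d$ is called locally visible if every $p\in\partial\Omega$ has open neighborhoods $V'\subseteq V$ in $\mathbb C^d$ such that $\Omega\cap V$ is connected and complete hyperbolic, and every couple of distinct points of $\partial\Omega\cap V'$ has the visibility condition with respect to $K_{\Omega\cap V}$. **Lemma.** If a bounded domain $\Omega\subset\mathbb C^d$ is locally visible, then $(\Omega,K_\Omega)$ is complete hyperbolic, that is, a complete metric space. -/

import Mathlib

open scoped ENNReal Topology

noncomputable section

namespace Kobayashi

/-- The Poincaré distance of the open unit disc of `ℂ`, normalized so that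
`poincareDist 0 r = artanh r` for `0 ≤ r < 1`. -/
def poincareDist (a b : ℂ) : ℝ :=
  Real.artanh (‖a - b‖ / ‖1 - starRingEnd ℂ a * b‖)

/-- `f` restricts to a holomorphic map from the open unit disc into `D`. -/
def IsHolomorphicDisc {d : ℕ} (D : Set (EuclideanSpace ℂ (Fin d)))
    (f : ℂ → EuclideanSpace ℂ (Fin d)) : Prop :=
  DifferentiableOn ℂ f (Metric.ball 0 1) ∧ Set.MapsTo f (Metric.ball 0 1) D

/-- The Lempert function of `D`: the infimum of the Poincaré distances of two points `a`, `b` of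
the unit disc over all holomorphic discs in `D` with `f a = x` and `f b = y`
(`⊤` if there is no such disc). -/
def lempert {d : ℕ} (D : Set (EuclideanSpace ℂ (Fin d)))
    (x y : EuclideanSpace ℂ (Fin d)) : ℝ≥0∞ :=
  ⨅ (f : ℂ → EuclideanSpace ℂ (Fin d)) (a : ℂ) (b : ℂ)
    (_ : IsHolomorphicDisc D f ∧ a ∈ Metric.ball (0 : ℂ) 1 ∧ b ∈ Metric.ball (0 : ℂ) 1 ∧
      f a = x ∧ f b = y), ENNReal.ofReal (poincareDist a b)

/-- The Kobayashi pseudodistance `K_D`: the infimum of the lengths of all finite chains of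
holomorphic discs in `D` from `x` to `y`. -/
def kobayashiDist {d : ℕ} (D : Set (EuclideanSpace ℂ (Fin d)))
    (x y : EuclideanSpace ℂ (Fin d)) : ℝ≥0∞ :=
  ⨅ (n : ℕ) (z : ℕ → EuclideanSpace ℂ (Fin d)) (_ : z 0 = x ∧ z n = y),
    ∑ i ∈ Finset.range n, lempert D (z i) (z (i + 1))

/-- `(D, K_D)` is a complete metric space: `K_D` is finite, separates the points of `D`, and
every `K_D`-Cauchy sequence in `D` converges with respect to `K_D` to a point of `D`. (Symmetry
and the triangle inequality hold for every `D`.) -/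
def IsCompleteHyperbolic {d : ℕ} (D : Set (EuclideanSpace ℂ (Fin d))) : Prop :=
  (∀ x ∈ D, ∀ y ∈ D, kobayashiDist D x y ≠ ⊤) ∧
  (∀ x ∈ D, ∀ y ∈ D, kobayashiDist D x y = 0 → x = y) ∧
  ∀ u : ℕ → EuclideanSpace ℂ (Fin d), (∀ n, u n ∈ D) →
    (∀ ε : ℝ≥0∞, 0 < ε → ∃ N : ℕ, ∀ m ≥ N, ∀ n ≥ N, kobayashiDist D (u m) (u n) < ε) →
    ∃ a ∈ D, Filter.Tendsto (fun n => kobayashiDist D (u n) a) Filter.atTop (𝓝 0)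

/-- `S` is (the image of) a geodesic segment `[x, y]_D` for `K_D`, that is, the image of an
isometric embedding `γ` of an interval `[0, L]` into `(D, K_D)` with `γ 0 = x` and `γ L = y`. -/
def IsGeodesicSegment {d : ℕ} (D : Set (EuclideanSpace ℂ (Fin d)))
    (x y : EuclideanSpace ℂ (Fin d)) (S : Set (EuclideanSpace ℂ (Fin d))) : Prop :=
  ∃ (L : ℝ) (γ : ℝ → EuclideanSpace ℂ (Fin d)), 0 ≤ L ∧
    Set.MapsTo γ (Set.Icc 0 L) D ∧ γ 0 = x ∧ γ L = y ∧
    (∀ s ∈ Set.Icc 0 L, ∀ t ∈ Set.Icc 0 L,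
      kobayashiDist D (γ s) (γ t) = ENNReal.ofReal |s - t|) ∧
    S = γ '' Set.Icc 0 L

/-- The couple `(p, q)` has the visibility condition with respect to the geodesics of `K_D`:
there are disjoint neighborhoods of `p` and `q` and a compact subset of `D` that meets every
geodesic segment joining a point of `D` in the first neighborhood to one in the second. -/
def HasVisibility {d : ℕ} (D : Set (EuclideanSpace ℂ (Fin d)))
    (p q : EuclideanSpace ℂ (Fin d)) : Prop :=
  ∃ Vp ∈ 𝓝 p, ∃ Vq ∈ 𝓝 q, Disjoint Vp Vq ∧
    ∃ K : Set (EuclideanSpace ℂ (Fin d)), IsCompact K ∧ K ⊆ D ∧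
      ∀ x ∈ Vp ∩ D, ∀ y ∈ Vq ∩ D, ∀ S : Set (EuclideanSpace ℂ (Fin d)),
        IsGeodesicSegment D x y S → (S ∩ K).Nonempty

/-- `Ω` is locally visible at the boundary point `p`. -/
def IsLocallyVisibleAt {d : ℕ} (Ω : Set (EuclideanSpace ℂ (Fin d)))
    (p : EuclideanSpace ℂ (Fin d)) : Prop :=
  ∃ V : Set (EuclideanSpace ℂ (Fin d)), IsOpen V ∧ p ∈ V ∧
    IsConnected (Ω ∩ V) ∧ IsCompleteHyperbolic (Ω ∩ V) ∧
    ∃ V' : Set (EuclideanSpace ℂ (Fin d)), IsOpen V' ∧ p ∈ V' ∧ V' ⊆ V ∧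
      ∀ q₁ ∈ frontier Ω ∩ V', ∀ q₂ ∈ frontier Ω ∩ V', q₁ ≠ q₂ → HasVisibility (Ω ∩ V) q₁ q₂

/-- `Ω` is locally visible, that is, locally visible at every boundary point. -/
def IsLocallyVisible {d : ℕ} (Ω : Set (EuclideanSpace ℂ (Fin d))) : Prop :=
  ∀ p ∈ frontier Ω, IsLocallyVisibleAt Ω p

end Kobayashi

end

/-!
The Schwarz lemma bounds the Euclidean distance on a bounded domain by a multiple of its Kobayashi
distance, so a `K_Ω`-Cauchy sequence converges to some `p` in the closure of `Ω`. If `p ∈ Ω`, the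
sequence `K_Ω`-converges to `p`, because `K_Ω` is continuous. If `p ∈ ∂Ω`, take a neighborhood `V`
of `p` with `Ω ∩ V` complete hyperbolic. By Royden's localization, a holomorphic disc in `Ω` whose
centre has `K_Ω`-distance at least `δ` from `Ω \ V` maps the disc of radius `tanh δ` into `V`; hence
`K_{Ω ∩ V}` is at most a constant times `K_Ω` at small scales near `p`. The sequence is therefore
`K_{Ω ∩ V}`-Cauchy, and its `K_{Ω ∩ V}`-limit is also its `K_Ω`-limit.
-/

open Metric Set Filter

namespace Kobayashi

lemma le_artanh {t : ℝ} (h0 : 0 ≤ t) (h1 : t < 1) : t ≤ Real.artanh t := by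
  have hsum := Real.hasSum_log_sub_log_of_abs_lt_one (abs_lt.2 ⟨by linarith, h1⟩)
  have hfirst := le_hasSum hsum 0 fun k _ ↦ by positivity
  rw [Real.artanh_eq_half_log ⟨by linarith, h1.le⟩, Real.log_div (by linarith) (by linarith)]
  norm_num at hfirst
  linarith

lemma artanh_le_div_one_sub {t : ℝ} (h0 : -1 < t) (h1 : t < 1) :
    Real.artanh t ≤ t / (1 - t) := by
  have hpos : 0 < (1 + t) / (1 - t) := div_pos (by linarith) (by linarith)
  rw [Real.artanh_eq_half_log ⟨h0.le, h1.le⟩]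
  calc 1 / 2 * Real.log ((1 + t) / (1 - t))
      ≤ 1 / 2 * ((1 + t) / (1 - t) - 1) := by gcongr; exact Real.log_le_sub_one_of_pos hpos
    _ = t / (1 - t) := by
      have : 1 - t ≠ 0 := by linarith
      field_simp
      ring

lemma continuousAt_artanh_zero : ContinuousAt Real.artanh 0 := by
  unfold Real.artanh
  exact ContinuousAt.log (by fun_prop (disch := norm_num)) (by norm_num)

lemma artanh_div_le {r t : ℝ} (hr : r ≤ 1) (h0 : 0 ≤ t) (h1 : t < r / 2) :
    Real.artanh (t / r) ≤ 2 / r * Real.artanh t := by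
  have hr0 : 0 < r := by linarith
  have hhalf : t / r < 1 / 2 := by rw [div_lt_iff₀ hr0]; linarith
  have hdiv : 0 ≤ t / r := by positivity
  calc Real.artanh (t / r)
      ≤ t / r / (1 - t / r) := artanh_le_div_one_sub (by linarith) (by linarith)
    _ ≤ t / r / (1 / 2) := by gcongr; linarith
    _ = 2 / r * t := by ring
    _ ≤ 2 / r * Real.artanh t := by gcongr; exact le_artanh h0 (by linarith)

lemma tanh_pos {δ : ℝ} (hδ : 0 < δ) : 0 < Real.tanh δ := by
  rw [Real.tanh_eq_sinh_div_cosh]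
  exact div_pos (Real.sinh_pos_iff.2 hδ) (Real.cosh_pos δ)

lemma artanh_lt_of_lt_tanh {t δ : ℝ} (h0 : 0 ≤ t) (ht : t < Real.tanh δ) :
    Real.artanh t < δ := by
  simpa only [Real.artanh_tanh] using
    Real.artanh_lt_artanh (by linarith) (Real.tanh_lt_one δ) ht

lemma tanh_le_self {δ : ℝ} (hδ : 0 < δ) : Real.tanh δ ≤ δ := by
  simpa only [Real.artanh_tanh] using le_artanh (tanh_pos hδ).le (Real.tanh_lt_one δ)

lemma le_mul_of_forall_gt {a b k η : ℝ≥0∞} (hk : k ≠ ⊤) (hη : a < η)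
    (h : ∀ ε, a < ε → ε ≤ η → b ≤ k * ε) : b ≤ k * a := by
  have hlim : Tendsto (k * ·) (𝓝[>] a) (𝓝 (k * a)) :=
    ((ENNReal.continuous_const_mul hk).tendsto a).mono_left nhdsWithin_le_nhds
  have : (𝓝[>] a).NeBot := nhdsGT_neBot_of_exists_gt ⟨η, hη⟩
  refine ge_of_tendsto hlim ?_
  filter_upwards [Ioc_mem_nhdsGT hη] with ε hε using h ε hε.1 hε.2

section Mobius

variable {a b ζ : ℂ}

/-- The automorphism `ζ ↦ (ζ + a) / (1 + conj a * ζ)` of the unit disc, which sends `0` to `a`. It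
is used to recentre holomorphic discs. -/
noncomputable def mobius (a ζ : ℂ) : ℂ := (ζ + a) / (1 + starRingEnd ℂ a * ζ)

@[simp]
lemma mobius_zero (a : ℂ) : mobius a 0 = a := by simp [mobius]

lemma sq_norm_one_add_conj_mul (a ζ : ℂ) :
    ‖1 + starRingEnd ℂ a * ζ‖ ^ 2 = ‖ζ + a‖ ^ 2 + (1 - ‖a‖ ^ 2) * (1 - ‖ζ‖ ^ 2) := by
  simp only [← Complex.normSq_eq_norm_sq, Complex.normSq_apply, Complex.add_re, Complex.add_im,
    Complex.mul_re, Complex.mul_im, Complex.conj_re, Complex.conj_im, Complex.one_re,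
    Complex.one_im]
  ring

lemma norm_add_lt_norm_one_add_conj_mul (ha : a ∈ ball (0 : ℂ) 1) (hζ : ζ ∈ ball (0 : ℂ) 1) :
    ‖ζ + a‖ < ‖1 + starRingEnd ℂ a * ζ‖ := by
  rw [mem_ball_zero_iff, ← sq_lt_one_iff₀ (norm_nonneg _)] at ha hζ
  refine lt_of_pow_lt_pow_left₀ 2 (norm_nonneg _) ?_
  rw [sq_norm_one_add_conj_mul]
  exact lt_add_of_pos_right _ (mul_pos (sub_pos.2 ha) (sub_pos.2 hζ))

lemma one_add_conj_mul_ne_zero (ha : a ∈ ball (0 : ℂ) 1) (hζ : ζ ∈ ball (0 : ℂ) 1) :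
    1 + starRingEnd ℂ a * ζ ≠ 0 :=
  norm_pos_iff.1 ((norm_nonneg _).trans_lt (norm_add_lt_norm_one_add_conj_mul ha hζ))

lemma mapsTo_mobius (ha : a ∈ ball (0 : ℂ) 1) :
    MapsTo (mobius a) (ball 0 1) (ball 0 1) := fun ζ hζ ↦ by
  have hlt := norm_add_lt_norm_one_add_conj_mul ha hζ
  rw [mem_ball_zero_iff, mobius, norm_div, div_lt_one ((norm_nonneg _).trans_lt hlt)]
  exact hlt

lemma differentiableOn_mobius (ha : a ∈ ball (0 : ℂ) 1) :
    DifferentiableOn ℂ (mobius a) (ball 0 1) :=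
  DifferentiableOn.div (by fun_prop) (by fun_prop) fun _ ↦ one_add_conj_mul_ne_zero ha

lemma neg_mem_ball (ha : a ∈ ball (0 : ℂ) 1) : -a ∈ ball (0 : ℂ) 1 := by
  simpa using ha

lemma mobius_mobius_neg (ha : a ∈ ball (0 : ℂ) 1) (hb : b ∈ ball (0 : ℂ) 1) :
    mobius a (mobius (-a) b) = b := by
  have hinner : 1 + starRingEnd ℂ (-a) * b ≠ 0 := one_add_conj_mul_ne_zero (neg_mem_ball ha) hb
  have houter : 1 + starRingEnd ℂ a * mobius (-a) b ≠ 0 :=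
    one_add_conj_mul_ne_zero ha (mapsTo_mobius (neg_mem_ball ha) hb)
  rw [mobius, div_eq_iff houter, mobius]
  rw [map_neg] at hinner ⊢
  linear_combination div_mul_cancel₀ (b + -a) hinner

lemma poincareDist_eq_artanh_norm_mobius (a b : ℂ) :
    poincareDist a b = Real.artanh ‖mobius (-a) b‖ := by
  rw [poincareDist, mobius, norm_div, map_neg, neg_mul, ← sub_eq_add_neg, ← sub_eq_add_neg,
    norm_sub_rev]

@[simp]
lemma poincareDist_zero_left (b : ℂ) : poincareDist 0 b = Real.artanh ‖b‖ := by
  simp [poincareDist]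

lemma poincareDist_comm (a b : ℂ) : poincareDist a b = poincareDist b a := by
  have hden : ‖1 - starRingEnd ℂ a * b‖ = ‖1 - starRingEnd ℂ b * a‖ := by
    rw [← Complex.norm_conj]
    simp [mul_comm]
  rw [poincareDist, poincareDist, norm_sub_rev, hden]

end Mobius

variable {d : ℕ} {D D' V : Set (EuclideanSpace ℂ (Fin d))} {x y : EuclideanSpace ℂ (Fin d)}
  {f : ℂ → EuclideanSpace ℂ (Fin d)} {u : ℕ → EuclideanSpace ℂ (Fin d)}

lemma IsHolomorphicDisc.mono (hf : IsHolomorphicDisc D f) (h : D ⊆ D') :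
    IsHolomorphicDisc D' f :=
  ⟨hf.1, hf.2.mono_right h⟩

lemma IsHolomorphicDisc.comp (hf : IsHolomorphicDisc D f) {φ : ℂ → ℂ}
    (hφ : DifferentiableOn ℂ φ (ball 0 1)) (hmaps : MapsTo φ (ball 0 1) (ball 0 1)) :
    IsHolomorphicDisc D (f ∘ φ) :=
  ⟨hf.1.comp hφ hmaps, hf.2.comp hmaps⟩

lemma IsHolomorphicDisc.lempert_le (hf : IsHolomorphicDisc D f) {w : ℂ}
    (hw : w ∈ ball (0 : ℂ) 1) : lempert D (f 0) (f w) ≤ ENNReal.ofReal (Real.artanh ‖w‖) := by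
  refine iInf_le_of_le f <| iInf_le_of_le 0 <| iInf_le_of_le w <|
    iInf_le_of_le ⟨hf, mem_ball_self one_pos, hw, rfl, rfl⟩ ?_
  rw [poincareDist_zero_left]

lemma exists_centered_disc_of_lempert_lt {ε : ℝ≥0∞} (h : lempert D x y < ε) :
    ∃ (g : ℂ → EuclideanSpace ℂ (Fin d)) (w : ℂ), IsHolomorphicDisc D g ∧
      w ∈ ball (0 : ℂ) 1 ∧ g 0 = x ∧ g w = y ∧ ENNReal.ofReal (Real.artanh ‖w‖) < ε := by
  simp only [lempert, iInf_lt_iff] at h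
  obtain ⟨f, a, b, ⟨hf, ha, hb, rfl, rfl⟩, hlt⟩ := h
  refine ⟨f ∘ mobius a, mobius (-a) b, hf.comp (differentiableOn_mobius ha) (mapsTo_mobius ha),
    mapsTo_mobius (neg_mem_ball ha) hb, congrArg f (mobius_zero a),
    congrArg f (mobius_mobius_neg ha hb), ?_⟩
  rwa [← poincareDist_eq_artanh_norm_mobius]

lemma lempert_comm (D : Set (EuclideanSpace ℂ (Fin d))) (x y : EuclideanSpace ℂ (Fin d)) :
    lempert D x y = lempert D y x := by
  have hle (x y) : lempert D x y ≤ lempert D y x := by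
    refine le_iInf fun f ↦ le_iInf fun a ↦ le_iInf fun b ↦ le_iInf fun ⟨hf, ha, hb, hfa, hfb⟩ ↦ ?_
    rw [poincareDist_comm]
    exact iInf_le_of_le f <| iInf_le_of_le b <| iInf_le_of_le a <|
      iInf_le_of_le ⟨hf, hb, ha, hfb, hfa⟩ le_rfl
  exact le_antisymm (hle x y) (hle y x)

lemma lempert_anti (h : D ⊆ D') (x y : EuclideanSpace ℂ (Fin d)) :
    lempert D' x y ≤ lempert D x y :=
  iInf_mono fun _ ↦ iInf_mono fun _ ↦ iInf_mono fun _ ↦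
    iInf_mono' fun hf ↦ ⟨⟨hf.1.mono h, hf.2⟩, le_rfl⟩

lemma lempert_le_of_ball_subset {s : ℝ} (hD : ball x s ⊆ D) (hy : y ∈ ball x s) :
    lempert D x y ≤ ENNReal.ofReal (Real.artanh (dist y x / s)) := by
  have hs : 0 < s := pos_of_mem_ball hy
  set e := NormedSpace.normalize (y - x)
  have he : ‖e‖ ≤ 1 := by
    rcases eq_or_ne (y - x) 0 with h | h
    · simp [e, h]
    · exact (NormedSpace.norm_normalize_eq_one_iff.2 h).le
  set g : ℂ → EuclideanSpace ℂ (Fin d) := fun ζ ↦ x + (s * ζ) • e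
  have hg : IsHolomorphicDisc D g := by
    refine ⟨by fun_prop, fun ζ hζ ↦ hD (mem_ball_iff_norm.2 ?_)⟩
    rw [mem_ball_zero_iff] at hζ
    calc ‖g ζ - x‖ = s * ‖ζ‖ * ‖e‖ := by simp [g, norm_smul, abs_of_pos hs]
      _ ≤ s * ‖ζ‖ := mul_le_of_le_one_right (by positivity) he
      _ < s := mul_lt_of_lt_one_right hs hζ
  set w : ℂ := ((dist y x / s : ℝ) : ℂ)
  have hw : ‖w‖ = dist y x / s := by
    rw [Complex.norm_real, Real.norm_of_nonneg (by positivity)]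
  have hsw : (s : ℂ) * w = (‖y - x‖ : ℝ) := by
    rw [← Complex.ofReal_mul, mul_div_cancel₀ _ hs.ne', dist_eq_norm]
  have hgw : g w = y := by
    simp only [g, hsw, Complex.coe_smul, e, NormedSpace.norm_smul_normalize, add_sub_cancel]
  have hg0 : g 0 = x := by simp [g]
  have hle := hg.lempert_le (w := w) (by rwa [mem_ball_zero_iff, hw, div_lt_one hs])
  rwa [hg0, hgw, hw] at hle

/-- The Schwarz lemma, divided by the diameter so that no boundedness assumption is needed:
dividing by `⊤` gives `0`. -/
lemma IsHolomorphicDisc.edist_div_ediam_le (hf : IsHolomorphicDisc D f) {w : ℂ}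
    (hw : w ∈ ball (0 : ℂ) 1) : edist (f 0) (f w) / ediam D ≤ ENNReal.ofReal ‖w‖ := by
  rcases eq_or_ne (ediam D) ⊤ with htop | htop
  · simp [htop]
  have hmaps : MapsTo f (ball 0 1) (closedBall (f 0) (diam D)) := fun ζ hζ ↦
    mem_closedBall.2 (dist_le_diam_of_mem' htop (hf.2 hζ) (hf.2 (mem_ball_self one_pos)))
  have hschwarz : dist (f w) (f 0) ≤ diam D * ‖w‖ := by
    simpa using Complex.dist_le_div_mul_dist_of_mapsTo_ball hf.1 hmaps hw
  refine ENNReal.div_le_of_le_mul' ?_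
  calc edist (f 0) (f w) = ENNReal.ofReal (dist (f w) (f 0)) := by rw [edist_comm, edist_dist]
    _ ≤ ENNReal.ofReal (diam D * ‖w‖) := ENNReal.ofReal_le_ofReal hschwarz
    _ = ediam D * ENNReal.ofReal ‖w‖ := by
      rw [ENNReal.ofReal_mul diam_nonneg, diam, ENNReal.ofReal_toReal htop]

lemma edist_div_ediam_le_lempert (D : Set (EuclideanSpace ℂ (Fin d)))
    (x y : EuclideanSpace ℂ (Fin d)) : edist x y / ediam D ≤ lempert D x y := by
  refine le_of_forall_gt_imp_ge_of_dense fun ε hε ↦ ?_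
  obtain ⟨g, w, hg, hw, rfl, rfl, hlt⟩ := exists_centered_disc_of_lempert_lt hε
  calc edist (g 0) (g w) / ediam D ≤ ENNReal.ofReal ‖w‖ := hg.edist_div_ediam_le hw
    _ ≤ ENNReal.ofReal (Real.artanh ‖w‖) :=
      ENNReal.ofReal_le_ofReal (le_artanh (norm_nonneg w) (mem_ball_zero_iff.1 hw))
    _ ≤ ε := hlt.le

lemma kobayashiDist_anti (h : D ⊆ D') (x y : EuclideanSpace ℂ (Fin d)) :
    kobayashiDist D' x y ≤ kobayashiDist D x y :=
  iInf_mono fun _ ↦ iInf_mono fun _ ↦ iInf_mono fun _ ↦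
    Finset.sum_le_sum fun _ _ ↦ lempert_anti h _ _

lemma kobayashiDist_le_sum (D : Set (EuclideanSpace ℂ (Fin d)))
    (z : ℕ → EuclideanSpace ℂ (Fin d)) (n : ℕ) :
    kobayashiDist D (z 0) (z n) ≤ ∑ i ∈ Finset.range n, lempert D (z i) (z (i + 1)) :=
  iInf_le_of_le n <| iInf_le_of_le z <| iInf_le_of_le ⟨rfl, rfl⟩ le_rfl

lemma exists_chain_of_kobayashiDist_lt {ε : ℝ≥0∞} (h : kobayashiDist D x y < ε) :
    ∃ (n : ℕ) (z : ℕ → EuclideanSpace ℂ (Fin d)), z 0 = x ∧ z n = y ∧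
      ∑ i ∈ Finset.range n, lempert D (z i) (z (i + 1)) < ε := by
  simpa only [kobayashiDist, iInf_lt_iff, exists_prop, and_assoc] using h

lemma kobayashiDist_self (D : Set (EuclideanSpace ℂ (Fin d))) (x : EuclideanSpace ℂ (Fin d)) :
    kobayashiDist D x x = 0 := by
  simpa using kobayashiDist_le_sum D (fun _ ↦ x) 0

lemma kobayashiDist_le_lempert_add (D : Set (EuclideanSpace ℂ (Fin d)))
    (x y z : EuclideanSpace ℂ (Fin d)) :
    kobayashiDist D x z ≤ lempert D x y + kobayashiDist D y z := by
  conv_rhs => simp only [kobayashiDist, ENNReal.add_iInf]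
  refine le_iInf fun n ↦ le_iInf fun v ↦ le_iInf ?_
  rintro ⟨rfl, rfl⟩
  simpa [Finset.sum_range_succ', add_comm] using
    kobayashiDist_le_sum D (fun i ↦ Nat.casesOn i x v) (n + 1)

lemma kobayashiDist_le_lempert (D : Set (EuclideanSpace ℂ (Fin d)))
    (x y : EuclideanSpace ℂ (Fin d)) : kobayashiDist D x y ≤ lempert D x y := by
  simpa [kobayashiDist_self] using kobayashiDist_le_lempert_add D x y y

lemma kobayashiDist_triangle (D : Set (EuclideanSpace ℂ (Fin d)))
    (x y z : EuclideanSpace ℂ (Fin d)) :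
    kobayashiDist D x z ≤ kobayashiDist D x y + kobayashiDist D y z := by
  have hchain (n : ℕ) (v : ℕ → EuclideanSpace ℂ (Fin d)) : kobayashiDist D (v 0) z ≤
      ∑ i ∈ Finset.range n, lempert D (v i) (v (i + 1)) + kobayashiDist D (v n) z := by
    induction n with
    | zero => simp
    | succ n ih =>
      rw [Finset.sum_range_succ, add_assoc]
      exact ih.trans (by gcongr; exact kobayashiDist_le_lempert_add ..)
  conv_rhs => enter [1]; rw [kobayashiDist]
  simp only [ENNReal.iInf_add]
  refine le_iInf fun n ↦ le_iInf fun v ↦ le_iInf ?_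
  rintro ⟨rfl, rfl⟩
  exact hchain n v

lemma kobayashiDist_comm (D : Set (EuclideanSpace ℂ (Fin d)))
    (x y : EuclideanSpace ℂ (Fin d)) : kobayashiDist D x y = kobayashiDist D y x := by
  have hchain (n : ℕ) (v : ℕ → EuclideanSpace ℂ (Fin d)) :
      kobayashiDist D (v n) (v 0) ≤ ∑ i ∈ Finset.range n, lempert D (v i) (v (i + 1)) := by
    induction n with
    | zero => simp [kobayashiDist_self]
    | succ n ih =>
      rw [Finset.sum_range_succ, add_comm (Finset.sum ..), lempert_comm _ (v n)]
      exact (kobayashiDist_le_lempert_add D (v (n + 1)) (v n) (v 0)).trans (by gcongr)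
  have hle (x y) : kobayashiDist D x y ≤ kobayashiDist D y x :=
    le_iInf fun n ↦ le_iInf fun v ↦ le_iInf fun ⟨h0, hn⟩ ↦ h0 ▸ hn ▸ hchain n v
  exact le_antisymm (hle x y) (hle y x)

lemma tendsto_kobayashiDist_nhds (hD : D ∈ 𝓝 x) :
    Tendsto (fun y ↦ kobayashiDist D y x) (𝓝 x) (𝓝 0) := by
  obtain ⟨s, hs, hsD⟩ := Metric.mem_nhds_iff.1 hD
  have hlim : Tendsto (fun y ↦ ENNReal.ofReal (Real.artanh (dist y x / s))) (𝓝 x) (𝓝 0) := by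
    have hdist : Tendsto (fun y ↦ dist y x / s) (𝓝 x) (𝓝 0) := by
      simpa using ((continuous_id.dist (continuous_const (y := x))).div_const s).tendsto x
    simpa using ENNReal.tendsto_ofReal (continuousAt_artanh_zero.tendsto.comp hdist)
  refine tendsto_of_tendsto_of_tendsto_of_le_of_le' tendsto_const_nhds hlim
    (Eventually.of_forall fun _ ↦ zero_le) ?_
  filter_upwards [ball_mem_nhds x hs] with y hy
  rw [kobayashiDist_comm]
  exact (kobayashiDist_le_lempert D x y).trans (lempert_le_of_ball_subset hsD hy)

lemma kobayashiDist_ne_top (hD : IsOpen D) (hconn : IsPreconnected D) (hx : x ∈ D)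
    (hy : y ∈ D) : kobayashiDist D x y ≠ ⊤ := by
  refine hconn.induction₂ (fun x y ↦ kobayashiDist D x y ≠ ⊤) (fun x hx ↦ ?_)
    (fun x y z _ _ _ hxy hyz ↦ ?_) (fun x y _ _ hxy ↦ ?_) hx hy
  · have hlt : ∀ᶠ y in 𝓝 x, kobayashiDist D y x < ⊤ :=
      (tendsto_kobayashiDist_nhds (hD.mem_nhds hx)).eventually_lt_const ENNReal.zero_lt_top
    filter_upwards [nhdsWithin_le_nhds hlt] with y hy
    rw [kobayashiDist_comm]
    exact hy.ne
  · exact ne_top_of_le_ne_top (ENNReal.add_ne_top.2 ⟨hxy, hyz⟩) (kobayashiDist_triangle D x y z)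
  · rwa [kobayashiDist_comm]

lemma edist_div_ediam_le_kobayashiDist (D : Set (EuclideanSpace ℂ (Fin d)))
    (x y : EuclideanSpace ℂ (Fin d)) : edist x y / ediam D ≤ kobayashiDist D x y := by
  refine le_iInf fun n ↦ le_iInf fun z ↦ le_iInf ?_
  rintro ⟨rfl, rfl⟩
  calc edist (z 0) (z n) / ediam D
      ≤ (∑ i ∈ Finset.range n, edist (z i) (z (i + 1))) / ediam D := by
        gcongr
        exact edist_le_range_sum_edist z n
    _ = ∑ i ∈ Finset.range n, edist (z i) (z (i + 1)) / ediam D := by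
        simp only [div_eq_mul_inv, Finset.sum_mul]
    _ ≤ ∑ i ∈ Finset.range n, lempert D (z i) (z (i + 1)) :=
        Finset.sum_le_sum fun _ _ ↦ edist_div_ediam_le_lempert ..

lemma eq_of_kobayashiDist_eq_zero (hD : Bornology.IsBounded D) (h : kobayashiDist D x y = 0) :
    x = y := by
  have hzero : edist x y / ediam D = 0 :=
    nonpos_iff_eq_zero.1 (h ▸ edist_div_ediam_le_kobayashiDist D x y)
  exact edist_eq_zero.1
    ((ENNReal.div_eq_zero_iff.1 hzero).resolve_right (isBounded_iff_ediam_ne_top.1 hD))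

lemma exists_pos_forall_dist_lt_of_kobayashiDist_lt (hD : Bornology.IsBounded D) {s : ℝ}
    (hs : 0 < s) :
    ∃ δ : ℝ, 0 < δ ∧ ∀ x y, kobayashiDist D x y < ENNReal.ofReal δ → dist x y < s := by
  have hpos : 0 < ENNReal.ofReal s / ediam D :=
    ENNReal.div_pos (ENNReal.ofReal_pos.2 hs).ne' (isBounded_iff_ediam_ne_top.1 hD)
  obtain ⟨δ, -, hδ, hlt⟩ := ENNReal.lt_iff_exists_real_btwn.1 hpos
  refine ⟨δ, ENNReal.ofReal_pos.1 hδ, fun x y hxy ↦ ?_⟩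
  contrapose! hxy
  calc ENNReal.ofReal δ ≤ ENNReal.ofReal s / ediam D := hlt.le
    _ ≤ edist x y / ediam D := by
      rw [edist_dist]
      gcongr
    _ ≤ kobayashiDist D x y := edist_div_ediam_le_kobayashiDist D x y

lemma IsHolomorphicDisc.inter_of_le_lempert (hf : IsHolomorphicDisc D f) {δ : ℝ} (hδ : 0 < δ)
    (hV : ∀ v ∈ D \ V, ENNReal.ofReal δ ≤ lempert D (f 0) v) :
    IsHolomorphicDisc (D ∩ V) (f ∘ fun ζ ↦ Real.tanh δ * ζ) := by
  have hnorm {ζ : ℂ} (hζ : ζ ∈ ball (0 : ℂ) 1) : ‖Real.tanh δ * ζ‖ < Real.tanh δ := by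
    rw [norm_mul, Complex.norm_real, Real.norm_of_nonneg (tanh_pos hδ).le]
    exact mul_lt_of_lt_one_right (tanh_pos hδ) (mem_ball_zero_iff.1 hζ)
  have hmaps : MapsTo (fun ζ : ℂ ↦ Real.tanh δ * ζ) (ball 0 1) (ball 0 1) := fun ζ hζ ↦
    mem_ball_zero_iff.2 ((hnorm hζ).trans (Real.tanh_lt_one δ))
  have hcomp := hf.comp (by fun_prop) hmaps
  refine ⟨hcomp.1, fun ζ hζ ↦ ⟨hcomp.2 hζ, ?_⟩⟩
  by_contra hζV
  refine (hV _ ⟨hcomp.2 hζ, hζV⟩).not_gt ((hf.lempert_le (hmaps hζ)).trans_lt ?_)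
  exact (ENNReal.ofReal_lt_ofReal_iff hδ).2 (artanh_lt_of_lt_tanh (norm_nonneg _) (hnorm hζ))

/-- Royden's localization, at the level of the Lempert function. -/
lemma lempert_inter_le {δ : ℝ} (hδ : 0 < δ)
    (hV : ∀ v ∈ D \ V, ENNReal.ofReal δ ≤ lempert D x v)
    (hxy : lempert D x y < ENNReal.ofReal (Real.tanh δ / 2)) :
    lempert (D ∩ V) x y ≤ ENNReal.ofReal (2 / Real.tanh δ) * lempert D x y := by
  refine le_mul_of_forall_gt ENNReal.ofReal_ne_top hxy fun ε hε hεle ↦ ?_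
  obtain ⟨g, w, hg, hw, rfl, rfl, hlt⟩ := exists_centered_disc_of_lempert_lt hε
  have hr := tanh_pos hδ
  have hw2 : ‖w‖ < Real.tanh δ / 2 :=
    (le_artanh (norm_nonneg w) (mem_ball_zero_iff.1 hw)).trans_lt
      ((ENNReal.ofReal_lt_ofReal_iff (half_pos hr)).1 (hlt.trans_le hεle))
  have hnorm : ‖w / (Real.tanh δ : ℂ)‖ = ‖w‖ / Real.tanh δ := by
    rw [norm_div, Complex.norm_real, Real.norm_of_nonneg hr.le]
  have hmem : w / (Real.tanh δ : ℂ) ∈ ball (0 : ℂ) 1 := by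
    rw [mem_ball_zero_iff, hnorm, div_lt_one hr]
    linarith
  have hle := (hg.inter_of_le_lempert hδ hV).lempert_le hmem
  rw [Function.comp_apply, Function.comp_apply, mul_zero,
    mul_div_cancel₀ w (Complex.ofReal_ne_zero.2 hr.ne'), hnorm] at hle
  calc lempert (D ∩ V) (g 0) (g w)
      ≤ ENNReal.ofReal (Real.artanh (‖w‖ / Real.tanh δ)) := hle
    _ ≤ ENNReal.ofReal (2 / Real.tanh δ * Real.artanh ‖w‖) :=
      ENNReal.ofReal_le_ofReal (artanh_div_le (Real.tanh_lt_one δ).le (norm_nonneg w) hw2)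
    _ = ENNReal.ofReal (2 / Real.tanh δ) * ENNReal.ofReal (Real.artanh ‖w‖) :=
      ENNReal.ofReal_mul (by positivity)
    _ ≤ ENNReal.ofReal (2 / Real.tanh δ) * ε := by gcongr

lemma kobayashiDist_inter_le {δ : ℝ} (hδ : 0 < δ)
    (hV : ∀ v ∈ D \ V, ENNReal.ofReal (2 * δ) ≤ kobayashiDist D x v)
    (hxy : kobayashiDist D x y < ENNReal.ofReal (Real.tanh δ / 2)) :
    kobayashiDist (D ∩ V) x y ≤ ENNReal.ofReal (2 / Real.tanh δ) * kobayashiDist D x y := by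
  refine le_mul_of_forall_gt ENNReal.ofReal_ne_top hxy fun ε hε hεle ↦ ?_
  obtain ⟨n, z, rfl, rfl, hlt⟩ := exists_chain_of_kobayashiDist_lt hε
  have hnear {i : ℕ} (hi : i ≤ n) : kobayashiDist D (z 0) (z i) ≤ ENNReal.ofReal δ :=
    calc kobayashiDist D (z 0) (z i)
        ≤ ∑ j ∈ Finset.range i, lempert D (z j) (z (j + 1)) := kobayashiDist_le_sum D z i
      _ ≤ ∑ j ∈ Finset.range n, lempert D (z j) (z (j + 1)) :=
        Finset.sum_le_sum_of_subset (Finset.range_mono hi)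
      _ ≤ ENNReal.ofReal (Real.tanh δ / 2) := (hlt.trans_le hεle).le
      _ ≤ ENNReal.ofReal δ := ENNReal.ofReal_le_ofReal (by linarith [tanh_le_self hδ])
  have hfar {i : ℕ} (hi : i ≤ n) (v) (hv : v ∈ D \ V) :
      ENNReal.ofReal δ ≤ lempert D (z i) v := by
    have hsum : ENNReal.ofReal δ + ENNReal.ofReal δ ≤ ENNReal.ofReal δ + lempert D (z i) v :=
      calc ENNReal.ofReal δ + ENNReal.ofReal δ = ENNReal.ofReal (2 * δ) := by
            rw [← ENNReal.ofReal_add hδ.le hδ.le, two_mul]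
        _ ≤ kobayashiDist D (z 0) v := hV v hv
        _ ≤ kobayashiDist D (z 0) (z i) + kobayashiDist D (z i) v := kobayashiDist_triangle ..
        _ ≤ ENNReal.ofReal δ + lempert D (z i) v :=
          add_le_add (hnear hi) (kobayashiDist_le_lempert ..)
    exact (ENNReal.add_le_add_iff_left ENNReal.ofReal_ne_top).1 hsum
  have hlink {i : ℕ} (hi : i ∈ Finset.range n) :
      lempert D (z i) (z (i + 1)) < ENNReal.ofReal (Real.tanh δ / 2) :=
    (Finset.single_le_sum_of_canonicallyOrdered
      (f := fun j ↦ lempert D (z j) (z (j + 1))) hi).trans_lt (hlt.trans_le hεle)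
  calc kobayashiDist (D ∩ V) (z 0) (z n)
      ≤ ∑ i ∈ Finset.range n, lempert (D ∩ V) (z i) (z (i + 1)) := kobayashiDist_le_sum _ z n
    _ ≤ ∑ i ∈ Finset.range n, ENNReal.ofReal (2 / Real.tanh δ) * lempert D (z i) (z (i + 1)) :=
      Finset.sum_le_sum fun i hi ↦
        lempert_inter_le hδ (hfar (Finset.mem_range.1 hi).le) (hlink hi)
    _ = ENNReal.ofReal (2 / Real.tanh δ) *
        ∑ i ∈ Finset.range n, lempert D (z i) (z (i + 1)) := (Finset.mul_sum ..).symm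
    _ ≤ ENNReal.ofReal (2 / Real.tanh δ) * ε := by gcongr

/-- Cauchy sequences for `K_D`, in the form in which they occur in `IsCompleteHyperbolic`. The
terms of the sequence are not required to lie in `D`. -/
def IsKobayashiCauchy (D : Set (EuclideanSpace ℂ (Fin d)))
    (u : ℕ → EuclideanSpace ℂ (Fin d)) : Prop :=
  ∀ ε : ℝ≥0∞, 0 < ε → ∃ N : ℕ, ∀ m ≥ N, ∀ n ≥ N, kobayashiDist D (u m) (u n) < ε

lemma IsKobayashiCauchy.cauchySeq (hu : IsKobayashiCauchy D u) (hD : Bornology.IsBounded D) :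
    CauchySeq u := by
  refine Metric.cauchySeq_iff.2 fun s hs ↦ ?_
  obtain ⟨δ, hδ, hdist⟩ := exists_pos_forall_dist_lt_of_kobayashiDist_lt hD hs
  obtain ⟨N, hN⟩ := hu _ (ENNReal.ofReal_pos.2 hδ)
  exact ⟨N, fun m hm n hn ↦ hdist _ _ (hN m hm n hn)⟩

lemma IsKobayashiCauchy.comp_add_right (hu : IsKobayashiCauchy D u) (k : ℕ) :
    IsKobayashiCauchy D fun n ↦ u (n + k) := fun ε hε ↦ by
  obtain ⟨N, hN⟩ := hu ε hε
  exact ⟨N, fun m hm n hn ↦ hN _ (le_add_right hm) _ (le_add_right hn)⟩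

lemma IsKobayashiCauchy.inter (hu : IsKobayashiCauchy D u) (hD : Bornology.IsBounded D) {s : ℝ}
    (hs : 0 < s) (hV : ∀ n, ball (u n) s ⊆ V) : IsKobayashiCauchy (D ∩ V) u := fun ε hε ↦ by
  obtain ⟨δ, hδ, hdist⟩ := exists_pos_forall_dist_lt_of_kobayashiDist_lt hD hs
  have hfar (n) (v) (hv : v ∈ D \ V) :
      ENNReal.ofReal (2 * (δ / 2)) ≤ kobayashiDist D (u n) v := by
    rw [mul_div_cancel₀ _ two_ne_zero]
    by_contra! hlt
    exact hv.2 (hV n (mem_ball'.2 (hdist _ _ hlt)))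
  have hr := tanh_pos (half_pos hδ)
  set k := ENNReal.ofReal (2 / Real.tanh (δ / 2))
  have hk : k ≠ 0 := (ENNReal.ofReal_pos.2 (by positivity)).ne'
  obtain ⟨N, hN⟩ := hu (min (ENNReal.ofReal (Real.tanh (δ / 2) / 2)) (ε / k))
    (lt_min (ENNReal.ofReal_pos.2 (half_pos hr)) (ENNReal.div_pos hε.ne' ENNReal.ofReal_ne_top))
  refine ⟨N, fun m hm n hn ↦ ?_⟩
  obtain ⟨hsmall, hlt⟩ := lt_min_iff.1 (hN m hm n hn)
  calc kobayashiDist (D ∩ V) (u m) (u n)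
      ≤ k * kobayashiDist D (u m) (u n) := kobayashiDist_inter_le (half_pos hδ) (hfar m) hsmall
    _ < k * (ε / k) := (ENNReal.mul_lt_mul_iff_right hk ENNReal.ofReal_ne_top).2 hlt
    _ = ε := ENNReal.mul_div_cancel hk ENNReal.ofReal_ne_top

lemma IsKobayashiCauchy.exists_tendsto_of_inter {p : EuclideanSpace ℂ (Fin d)}
    (hu : IsKobayashiCauchy D u) (hD : Bornology.IsBounded D) (huD : ∀ n, u n ∈ D)
    (hp : Tendsto u atTop (𝓝 p)) (hV : V ∈ 𝓝 p) (hcomplete : IsCompleteHyperbolic (D ∩ V)) :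
    ∃ a ∈ D, Tendsto (fun n ↦ kobayashiDist D (u n) a) atTop (𝓝 0) := by
  obtain ⟨s, hs, hsV⟩ := Metric.mem_nhds_iff.1 hV
  obtain ⟨N, hN⟩ := eventually_atTop.1 (hp.eventually (ball_mem_nhds p (half_pos hs)))
  have hball (n : ℕ) : ball (u (n + N)) (s / 2) ⊆ V :=
    (ball_subset_ball' (by linarith [mem_ball.1 (hN (n + N) le_add_self)])).trans hsV
  obtain ⟨a, ha, hlim⟩ := hcomplete.2.2 (fun n ↦ u (n + N))
    (fun n ↦ ⟨huD _, hball n (mem_ball_self (half_pos hs))⟩)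
    ((hu.comp_add_right N).inter hD (half_pos hs) hball)
  refine ⟨a, ha.1, (tendsto_add_atTop_iff_nat N).1 ?_⟩
  exact tendsto_of_tendsto_of_tendsto_of_le_of_le tendsto_const_nhds hlim (fun _ ↦ zero_le)
    fun n ↦ kobayashiDist_anti inter_subset_left _ _

end Kobayashi

open Kobayashi in
theorem lemma2p6_general {d : ℕ} {Ω : Set (EuclideanSpace ℂ (Fin d))} (hopen : IsOpen Ω)
    (hconn : IsPreconnected Ω) (hbdd : Bornology.IsBounded Ω)
    (hloc : ∀ p ∈ frontier Ω, ∃ V ∈ 𝓝 p, IsCompleteHyperbolic (Ω ∩ V)) :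
    IsCompleteHyperbolic Ω := by
  refine ⟨fun x hx y hy ↦ kobayashiDist_ne_top hopen hconn hx hy,
    fun x _ y _ ↦ eq_of_kobayashiDist_eq_zero hbdd, fun u huΩ (hu : IsKobayashiCauchy Ω u) ↦ ?_⟩
  obtain ⟨p, hp⟩ := cauchySeq_tendsto_of_complete (hu.cauchySeq hbdd)
  by_cases hpΩ : p ∈ Ω
  · exact ⟨p, hpΩ, (tendsto_kobayashiDist_nhds (hopen.mem_nhds hpΩ)).comp hp⟩
  · have hpfrontier : p ∈ frontier Ω := by
      rw [hopen.frontier_eq]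
      exact ⟨mem_closure_of_tendsto hp (Eventually.of_forall huΩ), hpΩ⟩
    obtain ⟨V, hV, hcomplete⟩ := hloc p hpfrontier
    exact hu.exists_tendsto_of_inter hbdd huΩ hp hV hcomplete

theorem lemma2p6 {d : ℕ} (Ω : Set (EuclideanSpace ℂ (Fin d)))
    (hopen : IsOpen Ω) (hconn : IsConnected Ω) (hbdd : Bornology.IsBounded Ω)
    (hvis : Kobayashi.IsLocallyVisible Ω) :
    Kobayashi.IsCompleteHyperbolic Ω :=
  lemma2p6_general hopen hconn.isPreconnected hbdd fun p hp ↦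
    let ⟨V, hV, hpV, _, hcomplete, _⟩ := hvis p hp
    ⟨V, hV.mem_nhds hpV, hcomplete⟩
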